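/- Let $N\ge 2$ and let $d_0,\dots,d_N$, $q_0,\dots,q_N$, $p_1,\dots,p_N$ be dimensions, with $d=\sum_{i=0}^N d_i$ and $p=\sum_{i=1}^N p_i$. Let $\mathcal X=\prod_{i=0}^N\mathcal X_i$ with $\mathcal X_i\subset\mathbb R^{d_i}$, and write $x=(x_0,\dots,x_N)$ for the elements of $\mathbb R^d$ and $y=(y_1,\dots,y_N)$, $y_i\in\mathbb R^{p_i}$, for the elements of $\mathbb R^p$. Let $f:\mathbb R^d\to\mathbb R$, $g_0:\mathbb R^d\to\mathbb R^{q_0}$ and $g_i:\mathbb R^{d_0}\times\mathbb R^{d_i}\to\mathbb R^{q_i}$ ($1\le i\le N$) be arbitrary functions, and consider the optimization problem $$(\mathrm{P})\qquad \min_{x\in\mathcal X} f(x)\quad\text{s.t.}\quad g_0(x)\le 0,\qquad g_i(x_0,x_i)\le 0\ \ (1\le i\le N),$$ where inequalities between vectors are componentwise. Let $\mathcal Y\subset\mathbb R^p$ be non-empty, convex and compact. Let $h(x,y)=\big(h_i(x_0,x_i,y_{-i})\big)_{1\le i\le N}$, where $y_{-i}=(y_j)_{j\ne i}$, be such that for every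 $x\in\mathcal X$ the map $h(x,\cdot)$ is continuous on $\mathcal Y$ and maps $\mathcal Y$ into $\mathcal Y$. Let $\mathcal S=\{(x,y)\in\mathcal X\times\mathcal Y : y=h(x,y)\}$ be the coupling solution set. A link function is a function $L:\mathcal X\times\mathcal Y\to\mathbb R^d$ with $L(x,y)=x$ for all $(x,y)\in\mathcal S$. For a link function $L=(L_0,\dots,L_N)$ put $\tilde f=f\circ L$, $\tilde g_0=g_0\circ L$ and $\tilde g_i(x,y)=g_i\big(L_0(x,y),L_i(x,y)\big)$, and consider the MDO (multidisciplinary design optimization) problem $$(\mathrm{M}_L)\qquad \min_{(x,y)\in\mathcal X\times\mathcal Y}\tilde f(x,y)\quad\text{s.t.}\quad \tilde g_0(x,y)\le 0,\quad \tilde g_i(x,y)\le 0,\quad y_i=h_i(x_0,x_i,y_{-i})\ \ (1\le i\le N).$$ A solution of either problem is a feasible point at which the objective attains its minimum over all feasible points. Then, for every link function $L$, the problems $(\mathrm{M}_L)$ and $(\mathrm{P})$ on all of $\mathcal X$ are equivalent: $(x,y)$ is a solution of $(\mathrm{M}_L)$ if and only if $(x,y)\in\mathcal S$ and $x$ is a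 solution of $(\mathrm{P})$; and $x$ is a solution of $(\mathrm{P})$ if and only if there is a $y$ such that $(x,y)$ is a solution of $(\mathrm{M}_L)$. Furthermore, the set of solutions of $(\mathrm{M}_L)$ does not depend on $L$. -/

import Mathlib

namespace MDO

/-- Design variables `x = (x_0, x_1, …, x_N)` with `x_i ∈ ℝ^{d_i}`; this space is `ℝ^d`. -/
abbrev Design {N : ℕ} (d : Fin (N + 1) → ℕ) : Type :=
  ∀ i : Fin (N + 1), EuclideanSpace ℝ (Fin (d i))

/-- Coupling variables `y = (y_1, …, y_N)` with `y_i ∈ ℝ^{p_i}`; this space is `ℝ^p`.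
Discipline number `i` (`1 ≤ i ≤ N`) is represented by an element of `Fin N`; its position among
the design variables is `i.succ`. -/
abbrev Coupling {N : ℕ} (p : Fin N → ℕ) : Type :=
  ∀ i : Fin N, EuclideanSpace ℝ (Fin (p i))

/-- Coupling variables `y_{-i} = (y_j)_{j ≠ i}` of all the disciplines but the `i`-th one. -/
abbrev CouplingExcept {N : ℕ} (p : Fin N → ℕ) (i : Fin N) : Type :=
  ∀ j : {j : Fin N // j ≠ i}, EuclideanSpace ℝ (Fin (p j))

/-- A family of coupling functions `(x_0, x_i, y_{-i}) ↦ h_i(x_0, x_i, y_{-i})`. -/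
abbrev CouplingFunctions {N : ℕ} (d : Fin (N + 1) → ℕ) (p : Fin N → ℕ) : Type :=
  ∀ i : Fin N, EuclideanSpace ℝ (Fin (d 0)) → EuclideanSpace ℝ (Fin (d i.succ)) →
    CouplingExcept p i → EuclideanSpace ℝ (Fin (p i))

/-- The map `h(x, y) = (h_i(x_0, x_i, y_{-i}))_i`. -/
def couplingMap {N : ℕ} {d : Fin (N + 1) → ℕ} {p : Fin N → ℕ}
    (h : CouplingFunctions d p) (x : Design d) (y : Coupling p) : Coupling p :=
  fun i => h i (x 0) (x i.succ) (fun j => y j)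

/-- The set `S` of all `(x, y)` in `X × Y` that solve the coupling equations `y = h(x, y)`. -/
def couplingSet {N : ℕ} {d : Fin (N + 1) → ℕ} {p : Fin N → ℕ}
    (X : Set (Design d)) (Y : Set (Coupling p)) (h : CouplingFunctions d p) :
    Set (Design d × Coupling p) :=
  {z | z.1 ∈ X ∧ z.2 ∈ Y ∧ z.2 = couplingMap h z.1 z.2}

/-- `L` is a link function: `L(x, y) = x` for every solution `(x, y)` of the coupling equations. -/
def IsLink {N : ℕ} {d : Fin (N + 1) → ℕ} {p : Fin N → ℕ}
    (X : Set (Design d)) (Y : Set (Coupling p)) (h : CouplingFunctions d p)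
    (L : Design d × Coupling p → Design d) : Prop :=
  ∀ z ∈ couplingSet X Y h, L z = z.1

/-- The data of an optimization problem: minimize `f(x)` over `x ∈ X_0 × ⋯ × X_N` subject to
`g_0(x) ≤ 0` and `g_i(x_0, x_i) ≤ 0` for `1 ≤ i ≤ N`. The functions are total: their values
outside the search space are arbitrary. -/
structure OptProblem {N : ℕ} (d q : Fin (N + 1) → ℕ) where
  /-- the factors `X_i` of the search space -/
  factor : ∀ i : Fin (N + 1), Set (EuclideanSpace ℝ (Fin (d i)))
  /-- the objective function `f` -/
  f : Design d → ℝ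
  /-- the global constraint function `g_0` -/
  g₀ : Design d → EuclideanSpace ℝ (Fin (q 0))
  /-- the disciplinary constraint functions `g_i(x_0, x_i)` -/
  g : ∀ i : Fin N, EuclideanSpace ℝ (Fin (d 0)) → EuclideanSpace ℝ (Fin (d i.succ)) →
    EuclideanSpace ℝ (Fin (q i.succ))

namespace OptProblem

variable {N : ℕ} {d q : Fin (N + 1) → ℕ}

/-- The search space `X = X_0 × ⋯ × X_N`. -/
def searchSpace (P : OptProblem d q) : Set (Design d) :=
  Set.univ.pi P.factor

/-- The feasible points; vector inequalities are componentwise. -/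
def feasible (P : OptProblem d q) : Set (Design d) :=
  {x | x ∈ P.searchSpace ∧ (∀ k, P.g₀ x k ≤ 0) ∧ ∀ i k, P.g i (x 0) (x i.succ) k ≤ 0}

/-- The solutions: the feasible points that minimize the objective over all feasible points. -/
def solutions (P : OptProblem d q) : Set (Design d) :=
  {x | x ∈ P.feasible ∧ ∀ x' ∈ P.feasible, P.f x ≤ P.f x'}

end OptProblem

/-- The data of an MDO problem: minimize `f(x, y)` over `(x, y) ∈ X × Y` subject to
`g_0(x, y) ≤ 0`, `g_i(x, y) ≤ 0` and `y_i = h_i(x_0, x_i, y_{-i})` for `1 ≤ i ≤ N`.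
The `i`-th constraint may depend on all of `(x, y)`, since the `i`-th constraint `g_i ∘ L`
of the transformed problem does so for a general link function `L`. -/
structure MDOProblem {N : ℕ} (d : Fin (N + 1) → ℕ) (p : Fin N → ℕ) (q : Fin (N + 1) → ℕ) where
  /-- the search space `X` -/
  X : Set (Design d)
  /-- the coupling space `Y` -/
  Y : Set (Coupling p)
  /-- the objective function -/
  f : Design d × Coupling p → ℝ
  /-- the global constraint function -/
  g₀ : Design d × Coupling p → EuclideanSpace ℝ (Fin (q 0))
  /-- the disciplinary constraint functions -/
  g : ∀ i : Fin N, Design d × Coupling p → EuclideanSpace ℝ (Fin (q i.succ))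
  /-- the coupling functions -/
  h : CouplingFunctions d p

namespace MDOProblem

variable {N : ℕ} {d : Fin (N + 1) → ℕ} {p : Fin N → ℕ} {q : Fin (N + 1) → ℕ}

/-- The feasible points; vector inequalities are componentwise. -/
def feasible (M : MDOProblem d p q) : Set (Design d × Coupling p) :=
  {z | z.1 ∈ M.X ∧ z.2 ∈ M.Y ∧ (∀ k, M.g₀ z k ≤ 0) ∧ (∀ i k, M.g i z k ≤ 0) ∧
    ∀ i, z.2 i = M.h i (z.1 0) (z.1 i.succ) (fun j => z.2 j)}

/-- The solutions: the feasible points that minimize the objective over all feasible points. -/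
def solutions (M : MDOProblem d p q) : Set (Design d × Coupling p) :=
  {z | z ∈ M.feasible ∧ ∀ z' ∈ M.feasible, M.f z ≤ M.f z'}

end MDOProblem

/-- The MDO problem on `X × Y` with coupling functions `h`, objective `f ∘ L` and
constraints `g ∘ L`. -/
def OptProblem.toMDO {N : ℕ} {d : Fin (N + 1) → ℕ} {p : Fin N → ℕ} {q : Fin (N + 1) → ℕ}
    (P : OptProblem d q) (Y : Set (Coupling p)) (h : CouplingFunctions d p)
    (L : Design d × Coupling p → Design d) : MDOProblem d p q where
  X := P.searchSpace
  Y := Y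
  f := P.f ∘ L
  g₀ := P.g₀ ∘ L
  g := fun i z => P.g i (L z 0) (L z i.succ)
  h := h

end MDO

/-!
On the coupling solution set `S` every link function returns the design part, so there the
transformed objective and constraints are the original ones. Since feasibility for the MDO problem
includes `(x, y) ∈ S`, a point is feasible for the MDO problem if and only if it lies in `S` and its
design part is feasible for the original problem (`mem_feasible_toMDO_iff`), and the two objectives
agree there. The equivalence of minimizers then only needs that every `x` of the search space is the
design part of a point of `S` (`exists_mem_couplingSet`): otherwise a minimizer of the MDO problem
could miss a better feasible `x`. Such a point is a fixed point of `h(x, ·)` on the convex compact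
set `Y`, so the substance is Brouwer's fixed-point theorem.

Brouwer's theorem is obtained from Scarf's lemma (`Scarf.exists_dominant_image_eq_univ`), a parity
argument for a finite set with several linear orders. A set of vertices is dominant if no vertex
exceeds its minimum in all the orders; pivoting (`Scarf.Dominant.exists_pair_insert`) shows that a
dominant set of codimension one extends to exactly two dominant sets of full size, apart from one
boundary exception, so the number of dominant sets that carry all colors is odd. For the points of
the standard simplex with denominator `m`, ordered by their coordinates, a dominant set is small;
with the color of `x` an index `i` such that `x i ≤ f x i`, it gives an `x` with
`x i ≤ f x i + ε` for all `i`, hence an approximate fixed point, since both coordinate sums are `1`.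
Compactness gives a fixed point in the simplex (`exists_fixedPoint_stdSimplex`), and a partition of
unity subordinate to a finite `ε`-net transfers this to any convex compact set
(`Convex.exists_fixedPoint`).
-/

/-! ### Scarf's lemma -/

namespace Scarf

variable {ι V : Type*}

/-- A set `σ` of vertices is dominant, for the preorders `s ≤_i t ↔ r i s ≤ r i t`, if no vertex
exceeds the minimum of `σ` in all of these preorders at once. -/
def Dominant (r : ι → V → ℕ) (σ : Finset V) : Prop :=
  ∀ t, ∃ i, ∀ s ∈ σ, r i t ≤ r i s

theorem Dominant.mono {r : ι → V → ℕ} {σ τ : Finset V} (h : Dominant r σ) (hτ : τ ⊆ σ) :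
    Dominant r τ := fun t => by
  obtain ⟨i, hi⟩ := h t
  exact ⟨i, fun s hs => hi s (hτ hs)⟩

variable [Fintype ι] [DecidableEq ι] [DecidableEq V]

/-- Let `σ` have as many vertices as there are colors, but not all the colors. If removing a vertex
leaves exactly the colors other than `i₀`, then `σ` has one repeated color, and precisely the two
vertices of that color can be removed in this way. -/
theorem even_card_filter_image_erase {c : V → ι} {σ : Finset V} (i₀ : ι)
    (hσ : σ.card = Fintype.card ι) (hc : σ.image c ≠ Finset.univ) :
    Even (σ.filter fun x => (σ.erase x).image c = Finset.univ.erase i₀).card := by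
  by_cases hne : ∃ x ∈ σ, (σ.erase x).image c = Finset.univ.erase i₀
  · obtain ⟨x, hxσ, hx⟩ := hne
    have hinj : ∀ y ∈ σ, (σ.erase y).image c = Finset.univ.erase i₀ →
        Set.InjOn c (σ.erase y : Finset V) := by
      intro y hyσ hy
      rw [← Finset.card_image_iff, hy, Finset.card_erase_of_mem (Finset.mem_univ _),
        Finset.card_erase_of_mem hyσ, hσ, Finset.card_univ]
    have hcx : c x ≠ i₀ := by
      intro h
      apply hc
      rw [← Finset.insert_erase hxσ, Finset.image_insert, hx, h,
        Finset.insert_erase (Finset.mem_univ _)]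
    have hmem : c x ∈ (σ.erase x).image c := by rw [hx]; simpa using hcx
    obtain ⟨y, hy, hyx⟩ := Finset.mem_image.1 hmem
    obtain ⟨hne, hyσ⟩ := Finset.mem_erase.1 hy
    have hy' : (σ.erase y).image c = Finset.univ.erase i₀ := by
      rw [← hx]
      ext i
      simp only [Finset.mem_image, Finset.mem_erase]
      constructor
      · rintro ⟨z, ⟨hzy, hz⟩, rfl⟩
        by_cases h : z = x
        · exact ⟨y, ⟨hne, hyσ⟩, by rw [h, hyx]⟩
        · exact ⟨z, ⟨h, hz⟩, rfl⟩
      · rintro ⟨z, ⟨hzx, hz⟩, rfl⟩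
        by_cases h : z = y
        · exact ⟨x, ⟨hne.symm, hxσ⟩, by rw [h, hyx]⟩
        · exact ⟨z, ⟨h, hz⟩, rfl⟩
    have : (σ.filter fun x => (σ.erase x).image c = Finset.univ.erase i₀) = {x, y} := by
      ext z
      simp only [Finset.mem_filter, Finset.mem_insert, Finset.mem_singleton]
      constructor
      · rintro ⟨hzσ, hz⟩
        by_contra! h
        exact hne (hinj z hzσ hz (by simp [hyσ, h.2.symm]) (by simp [hxσ, h.1.symm]) hyx)
      · rintro (rfl | rfl)
        · exact ⟨hxσ, hx⟩
        · exact ⟨hyσ, hy'⟩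
    rw [this, Finset.card_pair hne.symm]
    exact even_two
  · rw [Finset.filter_eq_empty_iff.2 fun x hx h => hne ⟨x, hx, h⟩]
    simp

variable [Fintype V]

/-- The pivoting step. Let `τ` be dominant with one vertex fewer than there are indices. Every vertex
of `τ` is the minimum of `τ` for some index, so exactly one pair `a ≠ b` of indices shares its
minimum. A vertex can be added to `τ` if and only if it is, for `k = a` or `k = b`, the greatest for
the index `k` among the vertices that lie above the minimum of `τ` for all the other indices. The
hypothesis `he` ensures that such vertices exist. -/
theorem Dominant.exists_pair_insert {r : ι → V → ℕ} (hr : ∀ i, Function.Injective (r i))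
    {e : ι → V} {τ : Finset V} (hτ : Dominant r τ) (hcard : τ.card + 1 = Fintype.card ι)
    {t₀ : V} (ht₀ : t₀ ∈ τ) (he : ∀ i j, i ≠ j → r i t₀ < r i (e j)) :
    ∃ x y, x ≠ y ∧ x ∉ τ ∧ y ∉ τ ∧
      ∀ z, z ∉ τ → (Dominant r (insert z τ) ↔ z = x ∨ z = y) := by
  have hmin : ∀ i, ∃ s ∈ τ, ∀ t ∈ τ, r i s ≤ r i t := fun i =>
    τ.exists_min_image (r i) ⟨t₀, ht₀⟩
  choose μ hμτ hμ using hmin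
  have hμ_eq : ∀ i, ∀ s ∈ τ, (∀ t ∈ τ, r i s ≤ r i t) → μ i = s := fun i s hs h =>
    hr i (le_antisymm (hμ i s hs) (h _ (hμτ i)))
  obtain ⟨a, -, b, -, hab, hμab⟩ := Finset.exists_ne_map_eq_of_card_lt_of_maps_to
    (s := Finset.univ) (t := τ) (f := μ) (by rw [Finset.card_univ]; omega)
    (fun i _ => hμτ i)
  -- every vertex of `τ` is a minimum, so `a` and `b` form the only pair with a common minimum
  have hinj : ∀ k l, k ≠ l → μ k = μ l → ∀ i j, i ≠ k → j ≠ k → μ i = μ j → i = j := by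
    intro k l hkl hμkl i j hi hj hij
    have hsurj : Set.SurjOn μ (Finset.univ.erase k : Finset ι) τ := by
      intro s hs
      obtain ⟨i, hi⟩ := hτ s
      have his := hμ_eq i s hs hi
      by_cases hik : i = k
      · exact ⟨l, by simpa using hkl.symm, by rw [← hμkl, ← hik, his]⟩
      · exact ⟨i, by simpa using hik, his⟩
    refine Finset.injOn_of_surjOn_of_card_le μ (fun i _ => hμτ i) hsurj ?_ (by simpa using hi)
      (by simpa using hj) hij
    rw [Finset.card_erase_of_mem (Finset.mem_univ _), Finset.card_univ]
    omega
  have hpair : ∀ i j, i ≠ j → μ i = μ j → (i = a ∧ j = b) ∨ (i = b ∧ j = a) := by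
    intro i j hij h
    have h1 := hinj a b hab hμab i j
    have h2 := hinj b a hab.symm hμab.symm i j
    by_cases hia : i = a <;> by_cases hib : i = b <;> by_cases hja : j = a <;>
      by_cases hjb : j = b <;> simp_all
  -- `M k` is the set of the candidates to replace the minimum of index `k`
  let M : ι → Finset V := fun k => Finset.univ.filter fun t => ∀ i, i ≠ k → r i (μ i) < r i t
  have hM : ∀ k t, t ∈ M k ↔ ∀ i, i ≠ k → r i (μ i) < r i t := fun k t => by simp [M]
  have hMle : ∀ k, ∀ t ∈ M k, r k t ≤ r k (μ k) := by
    intro k t ht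
    obtain ⟨i, hi⟩ := hτ t
    by_cases hik : i = k
    · exact hik ▸ hi _ (hμτ i)
    · exact absurd (hi _ (hμτ i)) (not_le.2 ((hM k t).1 ht i hik))
  have hMmax : ∀ k, ∃ x ∈ M k, ∀ t ∈ M k, r k t ≤ r k x := fun k =>
    (M k).exists_max_image (r k) ⟨e k, (hM k _).2 fun i hi =>
      (hμ i t₀ ht₀).trans_lt (he i k hi)⟩
  have hMτ : ∀ k l, k ≠ l → μ k = μ l → ∀ x ∈ M k, x ∉ τ := by
    intro k l hkl h x hx hxτ
    obtain ⟨i, hi⟩ := hτ x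
    have hix := hμ_eq i x hxτ hi
    by_cases hik : i = k
    · exact absurd ((hM k x).1 hx l hkl.symm) (by rw [← h, ← hik, hix]; exact lt_irrefl _)
    · exact absurd ((hM k x).1 hx i hik) (by rw [hix]; exact lt_irrefl _)
  have hback : ∀ k, ∀ x ∈ M k, (∀ t ∈ M k, r k t ≤ r k x) → Dominant r (insert x τ) := by
    intro k x hx hmax t
    by_cases ht : t ∈ M k
    · exact ⟨k, fun s hs => by
        rcases Finset.mem_insert.1 hs with rfl | hs
        · exact hmax t ht
        · exact (hMle k t ht).trans (hμ k s hs)⟩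
    · rw [hM] at ht
      push Not at ht
      obtain ⟨i, hik, hi⟩ := ht
      exact ⟨i, fun s hs => by
        rcases Finset.mem_insert.1 hs with rfl | hs
        · exact hi.trans ((hM k s).1 hx i hik).le
        · exact hi.trans (hμ i s hs)⟩
  obtain ⟨x, hxM, hx⟩ := hMmax a
  obtain ⟨y, hyM, hy⟩ := hMmax b
  refine ⟨x, y, ?_, hMτ a b hab hμab x hxM, hMτ b a hab.symm hμab.symm y hyM, fun z hz => ⟨?_, ?_⟩⟩
  · rintro rfl
    exact absurd (hMle b x hyM) (not_le.2 ((hM a x).1 hxM b hab.symm))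
  · intro hdom
    have hmin : ∀ j, ∃ k, μ k = μ j ∧ r k (μ k) < r k z := by
      intro j
      obtain ⟨k, hk⟩ := hdom (μ j)
      have hkj := hμ_eq k _ (hμτ j) fun t ht => hk t (Finset.mem_insert_of_mem ht)
      refine ⟨k, hkj, lt_of_le_of_ne ?_ fun h => hz ?_⟩
      · rw [hkj]; exact hk z (Finset.mem_insert_self _ _)
      · rw [← hr k h]; exact hμτ k
    obtain ⟨i, hi⟩ := hdom z
    have hiz : r i z ≤ r i (μ i) := hi _ (Finset.mem_insert_of_mem (hμτ i))
    have hzM : z ∈ M i := by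
      rw [hM]
      intro j hji
      obtain ⟨k, hkj, hk⟩ := hmin j
      by_cases h : k = j
      · exact h ▸ hk
      · obtain ⟨l, hli, hl⟩ := hmin i
        have hli' : l ≠ i := fun h => by subst h; omega
        have h1 := hpair k j h hkj
        have h2 := hpair l i hli' hli
        have hki : k ≠ i := fun h => by subst h; omega
        exfalso
        rcases h1 with ⟨hk, hj⟩ | ⟨hk, hj⟩ <;> rcases h2 with ⟨-, hi⟩ | ⟨-, hi⟩ <;>
          first
          | exact hji (hj.trans hi.symm)
          | exact hki (hk.trans hi.symm)
    have hzmax : ∀ t ∈ M i, r i t ≤ r i z := by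
      intro t ht
      obtain ⟨k, hk⟩ := hdom t
      by_cases h : k = i
      · exact h ▸ hk z (Finset.mem_insert_self _ _)
      · exact absurd (hk _ (Finset.mem_insert_of_mem (hμτ k)))
          (not_le.2 ((hM i t).1 ht k h))
    obtain ⟨l, hli, hl⟩ := hmin i
    have hli' : l ≠ i := fun h => by subst h; omega
    rcases hpair l i hli' hli with ⟨rfl, rfl⟩ | ⟨rfl, rfl⟩
    · exact Or.inr (hr i (le_antisymm (hy z hzM) (hzmax y hyM)))
    · exact Or.inl (hr i (le_antisymm (hx z hzM) (hzmax x hxM)))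
  · rintro (rfl | rfl)
    · exact hback a z hxM hx
    · exact hback b z hyM hy

/-- The boundary exception to pivoting: the set of all the slack vertices `e i` but `e i₀` has just
one dominant extension, by the greatest non-slack vertex for the index `i₀`. -/
theorem exists_unique_insert_image_erase {r : ι → V → ℕ} (hr : ∀ i, Function.Injective (r i))
    {e : ι → V} (he_min : ∀ i t, r i (e i) ≤ r i t)
    (he_max : ∀ i j t, i ≠ j → t ∉ Set.range e → r i t < r i (e j))
    (hV : ∃ t, t ∉ Set.range e) (i₀ : ι) :
    ∃ x, x ∉ (Finset.univ.erase i₀).image e ∧ ∀ z, z ∉ (Finset.univ.erase i₀).image e →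
      (Dominant r (insert z ((Finset.univ.erase i₀).image e)) ↔ z = x) := by
  obtain ⟨t₀, ht₀⟩ := hV
  obtain ⟨x, hxe, hx⟩ := (Finset.univ.filter fun t => t ∉ Set.range e).exists_max_image (r i₀)
    ⟨t₀, by simpa using ht₀⟩
  simp only [Finset.mem_filter, Finset.mem_univ, true_and] at hxe hx
  refine ⟨x, fun h => hxe ?_, fun z hz => ⟨fun hdom => ?_, ?_⟩⟩
  · obtain ⟨i, -, hi⟩ := Finset.mem_image.1 h
    exact ⟨i, hi⟩
  · have hmem : ∀ i, i ≠ i₀ → e i ∈ insert z ((Finset.univ.erase i₀).image e) := fun i hi =>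
      Finset.mem_insert_of_mem (Finset.mem_image_of_mem e (by simpa using hi))
    have key : ∀ t, t ∉ Set.range e → r i₀ t ≤ r i₀ z := by
      intro t ht
      obtain ⟨i, hi⟩ := hdom t
      by_cases h : i = i₀
      · exact h ▸ hi z (Finset.mem_insert_self _ _)
      · exact absurd ⟨i, hr i (le_antisymm (he_min i t) (hi _ (hmem i h)))⟩ ht
    have hze : z ∉ Set.range e := by
      rintro ⟨i, rfl⟩
      by_cases h : i = i₀
      · subst h
        exact ht₀ ⟨i, hr i (le_antisymm (he_min i _) (key t₀ ht₀))⟩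
      · exact hz (Finset.mem_image_of_mem e (by simpa using h))
    exact hr i₀ (le_antisymm (hx z hze) (key x hxe))
  · rintro rfl t
    by_cases ht : t ∈ Set.range e
    · obtain ⟨i, rfl⟩ := ht
      exact ⟨i, fun s _ => he_min i s⟩
    · refine ⟨i₀, fun s hs => ?_⟩
      rcases Finset.mem_insert.1 hs with rfl | hs
      · exact hx t ht
      · obtain ⟨j, hj, rfl⟩ := Finset.mem_image.1 hs
        exact (he_max i₀ j t (Finset.ne_of_mem_erase hj).symm ht).le

/-- **Scarf's lemma**. The slack vertices `e i` are the minimum for the index `i` and lie above all the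
non-slack vertices for the other indices. If `e i` has color `i`, then some dominant set contains
exactly one vertex of each color. -/
theorem exists_dominant_image_eq_univ [Nonempty ι] {r : ι → V → ℕ}
    (hr : ∀ i, Function.Injective (r i))
    {e : ι → V} (he_min : ∀ i t, r i (e i) ≤ r i t)
    (he_max : ∀ i j t, i ≠ j → t ∉ Set.range e → r i t < r i (e j))
    (hV : ∃ t, t ∉ Set.range e) {c : V → ι} (hc : ∀ i, c (e i) = i) :
    ∃ σ : Finset V, Dominant r σ ∧ σ.card = Fintype.card ι ∧ σ.image c = Finset.univ := by
  classical
  by_contra! hcon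
  obtain ⟨i₀⟩ := ‹Nonempty ι›
  -- double counting of the pairs `τ ⋖ σ` modulo 2, where `τ ∈ D` has all the colors but `i₀`
  let D : Finset (Finset V) := Finset.univ.filter fun τ =>
    Dominant r τ ∧ τ.card + 1 = Fintype.card ι ∧ τ.image c = Finset.univ.erase i₀
  let R : Finset (Finset V) := Finset.univ.filter fun σ =>
    Dominant r σ ∧ σ.card = Fintype.card ι
  let τ₀ : Finset V := (Finset.univ.erase i₀).image e
  have hcount : ∑ τ ∈ D, (R.filter fun σ => τ ⋖ σ).card
      = ∑ σ ∈ R, (D.filter fun τ => τ ⋖ σ).card :=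
    Finset.sum_card_bipartiteAbove_eq_sum_card_bipartiteBelow (fun τ σ : Finset V => τ ⋖ σ)
  have hright : Even (∑ σ ∈ R, (D.filter fun τ => τ ⋖ σ).card) := by
    refine Finset.even_sum _ fun σ hσ => ?_
    obtain ⟨hσ, hσc⟩ := (Finset.mem_filter.1 hσ).2
    have hD : (D.filter fun τ => τ ⋖ σ) = (σ.filter fun x =>
        (σ.erase x).image c = Finset.univ.erase i₀).image σ.erase := by
      ext τ
      simp only [D, Finset.mem_filter, Finset.mem_univ, true_and, Finset.mem_image,
        Finset.covBy_iff_exists_erase]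
      constructor
      · rintro ⟨⟨-, -, h⟩, x, hx, rfl⟩
        exact ⟨x, ⟨hx, h⟩, rfl⟩
      · rintro ⟨x, ⟨hx, h⟩, rfl⟩
        refine ⟨⟨hσ.mono (Finset.erase_subset _ _), ?_, h⟩, x, hx, rfl⟩
        rw [Finset.card_erase_add_one hx, hσc]
    rw [hD, Finset.card_image_of_injOn ((Finset.erase_injOn σ).mono fun x hx =>
      (Finset.mem_filter.1 hx).1)]
    exact even_card_filter_image_erase i₀ hσc (hcon σ hσ hσc)
  have habove : ∀ τ ∈ D, (R.filter fun σ => τ ⋖ σ) =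
      (Finset.univ.filter fun x => x ∉ τ ∧ Dominant r (insert x τ)).image (insert · τ) := by
    intro τ hτ
    obtain ⟨-, hτc, -⟩ := (Finset.mem_filter.1 hτ).2
    ext σ
    simp only [R, Finset.mem_filter, Finset.mem_univ, true_and, Finset.mem_image,
      Finset.covBy_iff_exists_insert]
    constructor
    · rintro ⟨⟨h, -⟩, x, hx, rfl⟩
      exact ⟨x, ⟨hx, h⟩, rfl⟩
    · rintro ⟨x, ⟨hx, h⟩, rfl⟩
      exact ⟨⟨h, by rw [Finset.card_insert_of_notMem hx, hτc]⟩, x, hx, rfl⟩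
  have hcard : ∀ τ ∈ D, (R.filter fun σ => τ ⋖ σ).card =
      (Finset.univ.filter fun x => x ∉ τ ∧ Dominant r (insert x τ)).card := by
    intro τ hτ
    rw [habove τ hτ, Finset.card_image_of_injOn]
    intro x hx y hy hxy
    exact (Finset.insert_inj (by simpa using (Finset.mem_filter.1 hx).2.1)).1 hxy
  obtain ⟨x, hx, hx'⟩ := exists_unique_insert_image_erase hr he_min he_max hV i₀
  have he : Function.Injective e := Function.LeftInverse.injective hc
  have hτ₀ : τ₀ ∈ D := by
    refine Finset.mem_filter.2 ⟨Finset.mem_univ _, ?_, ?_, ?_⟩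
    · exact ((hx' x hx).2 rfl).mono (Finset.subset_insert _ _)
    · rw [Finset.card_image_of_injective _ he, Finset.card_erase_add_one (Finset.mem_univ _),
        Finset.card_univ]
    · simp [τ₀, Finset.image_image, Function.comp_def, hc]
  have hone : (R.filter fun σ => τ₀ ⋖ σ).card = 1 := by
    rw [hcard τ₀ hτ₀, Finset.card_eq_one]
    refine ⟨x, ?_⟩
    ext z
    simp only [Finset.mem_filter, Finset.mem_univ, true_and, Finset.mem_singleton]
    exact ⟨fun h => (hx' z h.1).1 h.2, fun h => by subst h; exact ⟨hx, (hx' z hx).2 rfl⟩⟩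
  have htwo : Even (∑ τ ∈ D.erase τ₀, (R.filter fun σ => τ ⋖ σ).card) := by
    refine Finset.even_sum _ fun τ hτ => ?_
    obtain ⟨hne, hτD⟩ := Finset.mem_erase.1 hτ
    obtain ⟨hdom, hτc, hτi⟩ := (Finset.mem_filter.1 hτD).2
    -- a set of slack vertices with all the colors but `i₀` is `τ₀`
    have hexists : ∃ t ∈ τ, t ∉ Set.range e := by
      by_contra! h
      refine hne (Finset.eq_of_subset_of_card_le (fun t ht => ?_) ?_)
      · obtain ⟨i, rfl⟩ := h t ht
        have : c (e i) ∈ τ.image c := Finset.mem_image_of_mem c ht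
        rw [hτi, hc] at this
        exact Finset.mem_image_of_mem e this
      · have := (Finset.mem_filter.1 hτ₀).2.2.1
        omega
    obtain ⟨t, htτ, hte⟩ := hexists
    obtain ⟨y, z, hyz, hy, hz, hiff⟩ := hdom.exists_pair_insert hr hτc htτ
      fun i j hij => he_max i j t hij hte
    have : (Finset.univ.filter fun x => x ∉ τ ∧ Dominant r (insert x τ)) = {y, z} := by
      ext w
      simp only [Finset.mem_filter, Finset.mem_univ, true_and, Finset.mem_insert,
        Finset.mem_singleton]
      refine ⟨fun h => (hiff w h.1).1 h.2, fun h => ?_⟩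
      have hw : w ∉ τ := by rcases h with rfl | rfl <;> assumption
      exact ⟨hw, (hiff w hw).2 h⟩
    rw [hcard τ hτD, this, Finset.card_pair hyz]
    exact even_two
  rw [← hcount, ← Finset.add_sum_erase D _ hτ₀, hone] at hright
  rw [Nat.even_add] at hright
  exact absurd (hright.2 htwo) (by decide)

end Scarf

/-! ### Brouwer's fixed-point theorem -/

theorem IsCompact.exists_fixedPoint_of_forall_dist_le {E : Type*} [MetricSpace E] {K : Set E}
    (hK : IsCompact K) {f : E → E} (hf : ContinuousOn f K)
    (h : ∀ ε > 0, ∃ x ∈ K, dist (f x) x ≤ ε) : ∃ x ∈ K, f x = x := by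
  obtain ⟨x₁, hx₁, -⟩ := h 1 one_pos
  obtain ⟨x, hx, hmin⟩ := hK.exists_isMinOn (f := fun x => dist (f x) x) ⟨x₁, hx₁⟩
    (continuous_dist.comp_continuousOn (hf.prodMk continuousOn_id))
  refine ⟨x, hx, ?_⟩
  by_contra hne
  have hpos : 0 < dist (f x) x := dist_pos.2 hne
  obtain ⟨y, hy, hyd⟩ := h (dist (f x) x / 2) (half_pos hpos)
  have := isMinOn_iff.1 hmin y hy
  linarith

/-- Scarf's lemma for the points of `ι → ℕ` with coordinate sum `m` and an arbitrary coloring: there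
is a point `y` such that every index `i` for which the coordinate `y i` is not small is the color of
some point near `y`. -/
theorem Scarf.exists_grid_point {ι : Type*} [Fintype ι] [Nonempty ι] (m : ℕ)
    (c : (ι → ℕ) → ι) :
    ∃ y : ι → ℕ, ∑ k, y k = m ∧ ∀ i, y i < Fintype.card ι ∨
      ∃ x : ι → ℕ, ∑ k, x k = m ∧ c x = i ∧
        ∀ k, x k < y k + Fintype.card ι ∧ y k < x k + Fintype.card ι := by
  classical
  let T : Type _ := {x : ι → ℕ // x ∈ Finset.piAntidiag Finset.univ m}
  let _ : Fintype T := Finset.Subtype.fintype _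
  have hT : ∀ x : T, ∑ k, x.1 k = m := fun x => (Finset.mem_piAntidiag.1 x.2).1
  let mk : ∀ x : ι → ℕ, ∑ k, x k = m → T := fun x hx =>
    ⟨x, Finset.mem_piAntidiag.2 ⟨hx, fun i _ => Finset.mem_univ i⟩⟩
  obtain ⟨i₁⟩ := id ‹Nonempty ι›
  let v : ι → T ⊕ ι → ℕ := fun i =>
    Sum.elim (fun x => x.1 i + 1) fun j => if j = i then 0 else m + 2
  -- the preorders given by `v` become linear orders by breaking ties with an enumeration
  let r : ι → T ⊕ ι → ℕ := fun i t =>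
    v i t * Fintype.card (T ⊕ ι) + Fintype.equivFin (T ⊕ ι) t
  have hlt : ∀ i s t, v i s < v i t → r i s < r i t := by
    intro i s t h
    have h1 := (Fintype.equivFin (T ⊕ ι) s).2
    have h2 := Nat.mul_le_mul_right (Fintype.card (T ⊕ ι)) h
    simp only [r, Nat.succ_mul] at h2 ⊢
    omega
  have hle : ∀ i s t, r i s ≤ r i t → v i s ≤ v i t := fun i s t h =>
    le_of_not_gt fun h' => absurd (hlt i t s h') (not_lt.2 h)
  have hr : ∀ i, Function.Injective (r i) := by
    intro i s t h
    have hv : v i s = v i t := le_antisymm (hle i s t h.le) (hle i t s h.ge)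
    simp only [r, hv] at h
    exact (Fintype.equivFin (T ⊕ ι)).injective (Fin.ext (by omega))
  have hmin : ∀ i t, r i (Sum.inr i) ≤ r i t := by
    intro i t
    by_cases h : t = Sum.inr i
    · rw [h]
    · refine (hlt i _ _ ?_).le
      rcases t with x | j
      · simp [v]
      · have : j ≠ i := fun hj => h (by rw [hj])
        simp [v, this]
  have hmax : ∀ i j t, i ≠ j → t ∉ Set.range (Sum.inr : ι → T ⊕ ι) →
      r i t < r i (Sum.inr j) := by
    intro i j t hij ht
    refine hlt i _ _ ?_
    rcases t with x | k
    · have : x.1 i ≤ ∑ k, x.1 k := Finset.single_le_sum (fun _ _ => Nat.zero_le _)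
        (Finset.mem_univ i)
      rw [hT x] at this
      simp only [v, Sum.elim_inl, Sum.elim_inr, hij.symm, if_false]
      omega
    · exact absurd ⟨k, rfl⟩ ht
  let t₀ : T := mk (Pi.single i₁ m) (by simp)
  obtain ⟨σ, hdom, -, hσ⟩ := exists_dominant_image_eq_univ hr hmin hmax
    ⟨Sum.inl t₀, by simp⟩ (c := Sum.elim (fun x => c x.1) id) (fun _ => rfl)
  have hcol : ∀ i, Sum.inr i ∉ σ → ∃ x : T, Sum.inl x ∈ σ ∧ c x.1 = i := by
    intro i hi
    have : i ∈ σ.image (Sum.elim (fun x : T => c x.1) id) := by rw [hσ]; exact Finset.mem_univ i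
    obtain ⟨t, ht, hti⟩ := Finset.mem_image.1 this
    rcases t with x | j
    · exact ⟨x, ht, hti⟩
    · exact absurd ht (by simpa [show j = i from hti] using hi)
  have hbelow : ∀ z : T, ∃ i, Sum.inr i ∉ σ ∧ ∀ x : T, Sum.inl x ∈ σ → z.1 i ≤ x.1 i := by
    intro z
    obtain ⟨i, hi⟩ := hdom (Sum.inl z)
    refine ⟨i, fun h => ?_, fun x hx => ?_⟩
    · have := hle _ _ _ (hi _ h)
      simp [v] at this
    · have := hle _ _ _ (hi _ hx)
      simpa [v] using this
  obtain ⟨i₂, hi₂, -⟩ := hbelow t₀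
  obtain ⟨y, hy, -⟩ := hcol i₂ hi₂
  have hex : ∀ k, ∃ x : T, Sum.inl x ∈ σ ∧ ∀ x' : T, Sum.inl x' ∈ σ → x.1 k ≤ x'.1 k := by
    intro k
    obtain ⟨x, hx, h⟩ := (Finset.univ.filter fun x : T => Sum.inl x ∈ σ).exists_min_image
      (fun x => x.1 k) ⟨y, by simpa using hy⟩
    simp only [Finset.mem_filter, Finset.mem_univ, true_and] at hx h
    exact ⟨x, hx, h⟩
  choose w hwσ hw using hex
  -- a lower bound for the points of `σ`, which is within `card ι` of their common coordinate sum
  let lo : ι → ℕ := fun k => if Sum.inr k ∈ σ then 0 else (w k).1 k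
  have hlo : ∀ x : T, Sum.inl x ∈ σ → ∀ k, lo k ≤ x.1 k := by
    intro x hx k
    simp only [lo]
    split_ifs
    · exact Nat.zero_le _
    · exact hw k x hx
  have hsum : m < ∑ k, lo k + Fintype.card ι := by
    by_contra! h
    -- otherwise some grid point has all its coordinates above `lo`, contrary to dominance
    obtain ⟨k, hk, hk'⟩ := hbelow (mk
      (fun k => lo k + 1 + (Pi.single i₁ (m - (∑ k, lo k + Fintype.card ι)) : ι → ℕ) k) (by
        simp only [Finset.sum_add_distrib, Finset.sum_const, Finset.card_univ, smul_eq_mul,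
          mul_one, Finset.sum_pi_single', Finset.mem_univ, if_true]
        omega))
    have := hk' _ (hwσ k)
    simp only [mk, lo, hk, if_false] at this
    omega
  have hhi : ∀ x : T, Sum.inl x ∈ σ → ∀ k, x.1 k < lo k + Fintype.card ι := by
    intro x hx k
    have h1 : x.1 k - lo k ≤ ∑ k, (x.1 k - lo k) :=
      Finset.single_le_sum (f := fun k => x.1 k - lo k) (fun _ _ => Nat.zero_le _)
        (Finset.mem_univ k)
    have h2 : ∑ k, (x.1 k - lo k) + ∑ k, lo k = m := by
      rw [← Finset.sum_add_distrib]
      exact (Finset.sum_congr rfl fun k _ => Nat.sub_add_cancel (hlo x hx k)).trans (hT x)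
    omega
  refine ⟨y.1, hT y, fun i => ?_⟩
  by_cases hi : Sum.inr i ∈ σ
  · left
    simpa [lo, hi] using hhi y hy i
  · right
    obtain ⟨x, hx, hxi⟩ := hcol i hi
    refine ⟨x.1, hT x, hxi, fun k => ?_⟩
    have h1 := hlo x hx k
    have h2 := hlo y hy k
    have h3 := hhi x hx k
    have h4 := hhi y hy k
    omega

/-- **Brouwer's fixed-point theorem** for the standard simplex. -/
theorem exists_fixedPoint_stdSimplex {ι : Type*} [Fintype ι] [Nonempty ι]
    {f : (ι → ℝ) → ι → ℝ} (hf : ContinuousOn f (stdSimplex ℝ ι))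
    (hmaps : Set.MapsTo f (stdSimplex ℝ ι) (stdSimplex ℝ ι)) :
    ∃ x ∈ stdSimplex ℝ ι, f x = x := by
  refine (isCompact_stdSimplex ℝ ι).exists_fixedPoint_of_forall_dist_le hf fun ε hε => ?_
  set n := Fintype.card ι with hn
  have hn0 : (0 : ℝ) < n := Nat.cast_pos.2 Fintype.card_pos
  have hη : 0 < ε / n := div_pos hε hn0
  obtain ⟨δ, hδ, hfδ⟩ := Metric.uniformContinuousOn_iff.1
    ((isCompact_stdSimplex ℝ ι).uniformContinuousOn_of_continuous hf) (ε / n / 2) (half_pos hη)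
  obtain ⟨m, hm⟩ := exists_nat_gt (n / min δ (ε / n / 2))
  have hmin : 0 < min δ (ε / n / 2) := lt_min hδ (half_pos hη)
  have hm0 : (0 : ℝ) < m := (div_pos hn0 hmin).trans hm
  have hnm : (n : ℝ) / m < min δ (ε / n / 2) := by
    rw [div_lt_iff₀ hmin] at hm
    rwa [div_lt_iff₀ hm0, mul_comm]
  have hnmδ := hnm.trans_le (min_le_left _ _)
  have hnmε := hnm.trans_le (min_le_right _ _)
  let pt : (ι → ℕ) → ι → ℝ := fun x i => x i / m
  have hpt : ∀ x : ι → ℕ, ∑ k, x k = m → pt x ∈ stdSimplex ℝ ι := fun x hx =>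
    ⟨fun i => by positivity, by
      simp only [pt, ← Finset.sum_div, ← Nat.cast_sum, hx]
      exact div_self hm0.ne'⟩
  have hcolor : ∀ x : ι → ℕ, ∃ i, ∑ k, x k = m → pt x i ≤ f (pt x) i := by
    intro x
    by_cases hx : ∑ k, x k = m
    · obtain ⟨i, -, hi⟩ := Finset.exists_le_of_sum_le (s := Finset.univ) (f := pt x)
        (g := f (pt x)) Finset.univ_nonempty
        (by rw [(hpt x hx).2, (hmaps (hpt x hx)).2])
      exact ⟨i, fun _ => hi⟩
    · exact ⟨Classical.arbitrary ι, fun h => absurd h hx⟩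
  choose c hc using hcolor
  obtain ⟨y, hy, hyc⟩ := Scarf.exists_grid_point m c
  have hyS := hpt y hy
  have hclose : ∀ a b : ℕ, a < b + n → (a : ℝ) / m < b / m + n / m := by
    intro a b h
    rw [← add_div]
    exact div_lt_div_of_pos_right (by exact_mod_cast h) hm0
  have key : ∀ i, pt y i ≤ f (pt y) i + ε / n := by
    intro i
    rcases hyc i with h | ⟨x, hx, rfl, hxy⟩
    · have h1 := hclose (y i) 0 (by omega)
      have h2 := (hmaps hyS).1 i
      simp only [Nat.cast_zero, zero_div, zero_add] at h1
      change (y i : ℝ) / m ≤ _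
      linarith
    · have hd : dist (pt x) (pt y) < δ := by
        refine (dist_pi_lt_iff hδ).2 fun k => ?_
        rw [Real.dist_eq, abs_sub_lt_iff]
        have h1 := hclose _ _ (hxy k).1
        have h2 := hclose _ _ (hxy k).2
        constructor <;> simp only [pt] <;> linarith
      have h1 := (dist_le_pi_dist _ _ (c x)).trans_lt (hfδ _ (hpt x hx) _ hyS hd)
      rw [Real.dist_eq, abs_sub_lt_iff] at h1
      have h2 := hclose _ _ (hxy (c x)).2
      have h3 := hc x hx
      simp only [pt] at h1 h3 ⊢
      linarith [h1.1]
  refine ⟨pt y, hyS, (dist_pi_le_iff hε.le).2 fun i => ?_⟩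
  have hsum : ∑ k, (f (pt y) k + ε / n - pt y k) = ε := by
    rw [Finset.sum_sub_distrib, Finset.sum_add_distrib, (hmaps hyS).2, hyS.2, Finset.sum_const,
      Finset.card_univ, nsmul_eq_mul, ← hn]
    field_simp
    ring
  have hi := Finset.single_le_sum (f := fun k => f (pt y) k + ε / n - pt y k)
    (fun k _ => by linarith [key k]) (Finset.mem_univ i)
  rw [hsum] at hi
  have hle : ε / n ≤ ε := div_le_self hε.le (by exact_mod_cast Fintype.card_pos)
  rw [Real.dist_eq, abs_sub_le_iff]
  constructor <;> linarith [key i]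

/-- **Brouwer's fixed-point theorem** for a convex compact set `K`, in any normed space. The points of
a finite `ε`-net span a simplex that maps to `K` by `g`, and the normalized weights `φ` map `K` back
to the simplex so that `g ∘ φ` moves each point by at most `ε`. -/
theorem Convex.exists_fixedPoint {E : Type*} [NormedAddCommGroup E] [NormedSpace ℝ E] {K : Set E}
    (hconv : Convex ℝ K) (hcomp : IsCompact K) (hne : K.Nonempty) {f : E → E}
    (hf : ContinuousOn f K) (hmaps : Set.MapsTo f K K) : ∃ x ∈ K, f x = x := by
  refine hcomp.exists_fixedPoint_of_forall_dist_le hf fun ε hε => ?_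
  obtain ⟨t, htK, htfin, hcover⟩ := hcomp.finite_cover_balls hε
  have := htfin.fintype
  have hcov : ∀ y ∈ K, ∃ x : t, dist y x < ε := fun y hy => by
    obtain ⟨x, hx, hxy⟩ := Set.mem_iUnion₂.1 (hcover hy)
    exact ⟨⟨x, hx⟩, hxy⟩
  obtain ⟨y₀, hy₀⟩ := hne
  have : Nonempty t := ⟨(hcov y₀ hy₀).choose⟩
  let w : t → E → ℝ := fun x y => max 0 (ε - dist y x)
  have hw : ∀ x y, 0 ≤ w x y := fun x y => le_max_left _ _
  have hwsum : ∀ y ∈ K, 0 < ∑ x, w x y := fun y hy => by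
    obtain ⟨x, hx⟩ := hcov y hy
    exact Finset.sum_pos' (fun x _ => hw x y)
      ⟨x, Finset.mem_univ _, lt_max_of_lt_right (sub_pos.2 hx)⟩
  let g : (t → ℝ) → E := fun l => ∑ x, l x • (x : E)
  have hg : Continuous g := by fun_prop
  have hgK : Set.MapsTo g (stdSimplex ℝ t) K := fun l hl =>
    hconv.sum_mem (fun x _ => hl.1 x) hl.2 fun x _ => htK x.2
  let φ : E → t → ℝ := fun y x => w x y / ∑ x', w x' y
  have hφ : ContinuousOn φ K := by
    refine continuousOn_pi.2 fun x => ContinuousOn.div ?_ ?_ fun y hy => (hwsum y hy).ne'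
    · exact Continuous.continuousOn (by fun_prop)
    · exact Continuous.continuousOn (by fun_prop)
  have hφK : Set.MapsTo φ K (stdSimplex ℝ t) := fun y hy =>
    ⟨fun x => div_nonneg (hw x y) (hwsum y hy).le, by
      simp only [φ, ← Finset.sum_div]
      exact div_self (hwsum y hy).ne'⟩
  obtain ⟨l, hl, hfix⟩ := exists_fixedPoint_stdSimplex
    (f := fun l => φ (f (g l)))
    (hφ.comp (hf.comp hg.continuousOn hgK) (hmaps.comp hgK)) (hφK.comp (hmaps.comp hgK))
  refine ⟨g l, hgK hl, ?_⟩
  set z := f (g l) with hz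
  have hzK : z ∈ K := hmaps (hgK hl)
  have hgl : g l = ∑ x, φ z x • (x : E) := by simp only [g, hfix]
  have hsum : ∑ x, φ z x = 1 := (hφK hzK).2
  have hterm : ∀ x : t, ‖φ z x • (z - x)‖ ≤ φ z x * ε := by
    intro x
    rw [norm_smul, Real.norm_of_nonneg ((hφK hzK).1 x), ← dist_eq_norm]
    rcases le_or_gt ε (dist z x) with h | h
    · have : φ z x = 0 := by simp [φ, w, h]
      simp [this]
    · exact mul_le_mul_of_nonneg_left h.le ((hφK hzK).1 x)
  calc dist z (g l) = ‖∑ x, φ z x • (z - x)‖ := by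
        rw [dist_eq_norm, hgl]
        simp only [smul_sub, Finset.sum_sub_distrib, ← Finset.sum_smul, hsum, one_smul]
    _ ≤ ∑ x, φ z x * ε := norm_sum_le_of_le _ fun x _ => hterm x
    _ = ε := by rw [← Finset.sum_mul, hsum, one_mul]

/-! ### Equivalence of the optimization problems -/

/-- By Brouwer's theorem the coupling equations are solvable for every admissible design. -/
theorem exists_mem_couplingSet {N : ℕ} {d : Fin (N + 1) → ℕ} {p : Fin N → ℕ}
    {X : Set (MDO.Design d)} {Y : Set (MDO.Coupling p)} (hY_conv : Convex ℝ Y)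
    (hY_comp : IsCompact Y) (hY_ne : Y.Nonempty) {h : MDO.CouplingFunctions d p}
    {x : MDO.Design d} (hx : x ∈ X) (h_maps : ∀ y ∈ Y, MDO.couplingMap h x y ∈ Y)
    (h_cont : ContinuousOn (fun y => MDO.couplingMap h x y) Y) :
    ∃ y, (x, y) ∈ MDO.couplingSet X Y h := by
  obtain ⟨y, hy, hfix⟩ := hY_conv.exists_fixedPoint hY_comp hY_ne h_cont h_maps
  exact ⟨y, hx, hy, hfix.symm⟩

theorem mem_feasible_toMDO_iff {N : ℕ} {d q : Fin (N + 1) → ℕ} {p : Fin N → ℕ}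
    {P : MDO.OptProblem d q} {Y : Set (MDO.Coupling p)} {h : MDO.CouplingFunctions d p}
    {L : MDO.Design d × MDO.Coupling p → MDO.Design d} (hL : MDO.IsLink P.searchSpace Y h L)
    {z : MDO.Design d × MDO.Coupling p} :
    z ∈ (P.toMDO Y h L).feasible ↔ z ∈ MDO.couplingSet P.searchSpace Y h ∧ z.1 ∈ P.feasible := by
  constructor
  · rintro ⟨hX, hY, hg₀, hg, hh⟩
    have hS : z ∈ MDO.couplingSet P.searchSpace Y h := ⟨hX, hY, funext hh⟩
    have hLz := hL z hS
    simp only [MDO.OptProblem.toMDO, Function.comp_apply, hLz] at hg₀ hg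
    exact ⟨hS, hX, hg₀, hg⟩
  · rintro ⟨hS, hX, hg₀, hg⟩
    refine ⟨hX, hS.2.1, ?_, ?_, congrFun hS.2.2⟩ <;>
      simpa only [MDO.OptProblem.toMDO, Function.comp_apply, hL z hS]

theorem mem_solutions_toMDO_iff {N : ℕ} {d q : Fin (N + 1) → ℕ} {p : Fin N → ℕ}
    {P : MDO.OptProblem d q} {Y : Set (MDO.Coupling p)} {h : MDO.CouplingFunctions d p}
    (hS : ∀ x ∈ P.searchSpace, ∃ y, (x, y) ∈ MDO.couplingSet P.searchSpace Y h)
    {L : MDO.Design d × MDO.Coupling p → MDO.Design d} (hL : MDO.IsLink P.searchSpace Y h L)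
    {z : MDO.Design d × MDO.Coupling p} :
    z ∈ (P.toMDO Y h L).solutions ↔
      z ∈ MDO.couplingSet P.searchSpace Y h ∧ z.1 ∈ P.solutions := by
  have hf : ∀ z ∈ MDO.couplingSet P.searchSpace Y h, (P.toMDO Y h L).f z = P.f z.1 := fun z hz =>
    congrArg P.f (hL z hz)
  constructor
  · rintro ⟨hz, hmin⟩
    obtain ⟨hzS, hzP⟩ := (mem_feasible_toMDO_iff hL).1 hz
    refine ⟨hzS, hzP, fun x' hx' => ?_⟩
    obtain ⟨y', hy'⟩ := hS x' hx'.1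
    have := hmin (x', y') ((mem_feasible_toMDO_iff hL).2 ⟨hy', hx'⟩)
    rwa [hf z hzS, hf _ hy'] at this
  · rintro ⟨hzS, hzP, hmin⟩
    refine ⟨(mem_feasible_toMDO_iff hL).2 ⟨hzS, hzP⟩, fun z' hz' => ?_⟩
    obtain ⟨hzS', hzP'⟩ := (mem_feasible_toMDO_iff hL).1 hz'
    rw [hf z hzS, hf z' hzS']
    exact hmin _ hzP'

theorem proposition2 {N : ℕ} (hN : 2 ≤ N)
    {d q : Fin (N + 1) → ℕ} {p : Fin N → ℕ}
    (P : MDO.OptProblem d q)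
    (Y : Set (MDO.Coupling p)) (hY_conv : Convex ℝ Y) (hY_comp : IsCompact Y)
    (hY_ne : Y.Nonempty)
    (h : MDO.CouplingFunctions d p)
    (h_maps : ∀ x ∈ P.searchSpace, ∀ y ∈ Y, MDO.couplingMap h x y ∈ Y)
    (h_cont : ∀ x ∈ P.searchSpace, ContinuousOn (fun y => MDO.couplingMap h x y) Y)
    (L : MDO.Design d × MDO.Coupling p → MDO.Design d)
    (hL : MDO.IsLink P.searchSpace Y h L) :
    -- the solutions of the MDO problem are the solutions of the coupling equations whose
    -- design part solves the original problem on all of the search space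
    (∀ (x : MDO.Design d) (y : MDO.Coupling p),
      (x, y) ∈ (P.toMDO Y h L).solutions ↔
        (x, y) ∈ MDO.couplingSet P.searchSpace Y h ∧ x ∈ P.solutions) ∧
    -- every solution of the original problem arises from a solution of the MDO problem
    (∀ x : MDO.Design d,
      x ∈ P.solutions ↔ ∃ y : MDO.Coupling p, (x, y) ∈ (P.toMDO Y h L).solutions) ∧
    -- the solutions do not depend on the link function
    (∀ L' : MDO.Design d × MDO.Coupling p → MDO.Design d,
      MDO.IsLink P.searchSpace Y h L' →
        (P.toMDO Y h L').solutions = (P.toMDO Y h L).solutions) := by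

  have hS : ∀ x ∈ P.searchSpace, ∃ y, (x, y) ∈ MDO.couplingSet P.searchSpace Y h :=
    fun x hx => exists_mem_couplingSet hY_conv hY_comp hY_ne hx (h_maps x hx) (h_cont x hx)
  refine ⟨fun x y => mem_solutions_toMDO_iff hS hL, fun x => ⟨fun hx => ?_, ?_⟩,
    fun L' hL' => Set.ext fun z => ?_⟩
  · obtain ⟨y, hy⟩ := hS x hx.1.1
    exact ⟨y, (mem_solutions_toMDO_iff hS hL).2 ⟨hy, hx⟩⟩
  · rintro ⟨y, hy⟩
    exact ((mem_solutions_toMDO_iff hS hL).1 hy).2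
  · rw [mem_solutions_toMDO_iff hS hL', mem_solutions_toMDO_iff hS hL]
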